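/- Let $(\Omega,\mathcal A,P)$ be a probability space and let $f:\Omega\times\mathbb R^d\to\mathbb R$, with $f_\xi=f(\xi,\cdot)$. Assume: 1. for every $\xi\in\Omega$, $f_\xi$ is convex and $L_\xi$-smooth (that is, differentiable with $L_\xi$-Lipschitz gradient), where $\xi\mapsto L_\xi\in[0,\infty)$ is measurable and $\operatorname{ess\,sup}_{\xi} L_\xi<\infty$; 2. for every $x\in\mathbb R^d$, the maps $\xi\mapsto f_\xi(x)$ and $\xi\mapsto\nabla f_\xi(x)$ are measurable and square-integrable with respect to $P$; 3. there is a measurable set $\widetilde\Omega\subset\Omega$ with $P(\widetilde\Omega)>0$ such that for every $\xi\in\widetilde\Omega$ the function $f_\xi$ is $\mu_\xi$-strongly convex for some $\mu_\xi>0$. For a step size $\alpha>0$ consider the Markov chain of stochastic gradient descent, $x_{k+1}=\varphi_\alpha(\xi_k,x_k)$ with $\varphi_\alpha(\xi,x)=x-\alpha\nabla f_\xi(x)$ and i.i.d. samples $\xi_k\sim P$. Its transition probabilities are $P_\alpha(B,x)=P(\{\xi\in\Omega : \varphi_\alpha(\xi,x)\in B\})$ for Borel sets $B\subset\mathbb R^d$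 and $x\in\mathbb R^d$. Then there is $\alpha_0>0$ such that for every $\alpha\in(0,\alpha_0)$ there is exactly one probability measure $\mu_\alpha^*$ on the Borel sets of $\mathbb R^d$ that is invariant, i.e. satisfies $$\mu_\alpha^*(B)=\int_{\mathbb R^d}P_\alpha(B,x)\,d\mu_\alpha^*(x)\qquad\text{for every Borel set } B\subset\mathbb R^d .$$ -/

import Mathlib

open MeasureTheory
open scoped NNReal ENNReal

/-- A function on `ℝ^d` is `K`-smooth if it is differentiable and its gradient is
Lipschitz continuous with constant `K` (Euclidean norm). -/
def IsLSmooth {d : ℕ} (K : ℝ≥0) (g : EuclideanSpace ℝ (Fin d) → ℝ) : Prop :=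
  Differentiable ℝ g ∧ LipschitzWith K (gradient g)

/-- One step `φ_α(ξ, x) = x - α ∇f_ξ(x)` of stochastic gradient descent. -/
noncomputable def sgdStep {Ω : Type*} {d : ℕ} (f : Ω → EuclideanSpace ℝ (Fin d) → ℝ) (α : ℝ)
    (ξ : Ω) (x : EuclideanSpace ℝ (Fin d)) : EuclideanSpace ℝ (Fin d) :=
  x - α • gradient (f ξ) x

/-- The transition probability `P(B, x)`: the probability that the next iterate lies in `B`,
given that the current iterate is `x`, where the sample `ξ` has law `P`. -/
noncomputable def sgdTransition {Ω : Type*} [MeasurableSpace Ω] {d : ℕ} (P : Measure Ω)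
    (f : Ω → EuclideanSpace ℝ (Fin d) → ℝ) (α : ℝ) (B : Set (EuclideanSpace ℝ (Fin d)))
    (x : EuclideanSpace ℝ (Fin d)) : ℝ≥0∞ :=
  P {ξ | sgdStep f α ξ x ∈ B}

/-- `μ` is invariant under the SGD Markov chain: `μ(B) = ∫ P(B, x) dμ(x)` for all Borel `B`. -/
def IsSGDInvariant {Ω : Type*} [MeasurableSpace Ω] {d : ℕ} (P : Measure Ω)
    (f : Ω → EuclideanSpace ℝ (Fin d) → ℝ) (α : ℝ)
    (μ : Measure (EuclideanSpace ℝ (Fin d))) : Prop :=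
  ∀ B : Set (EuclideanSpace ℝ (Fin d)), MeasurableSet B →
    μ B = ∫⁻ x, sgdTransition P f α B x ∂μ

/-! For small `α` one step contracts in mean square: monotone gradients gain a term of order `α` on
an event of positive probability, while the Lipschitz bound costs order `α ^ 2`
(`eLpNorm_sgdStep_sub_le`). Existence: on `L²` of the i.i.d. sequence space, sending `X` to `Φ (ω 0,
X (tail of ω))` is a contraction. Head and tail are independent, so the law of its fixed point is
stationary (`exists_stationary_of_contracting`). Uniqueness: averaging a bounded Lipschitz
observable over `n` steps keeps its stationary integrals and multiplies its Lipschitz constant by `r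
^ n`, so these integrals agree for all stationary laws (`integral_eq_of_stationary`), and characters
suffice. No moments of the competing law are needed. -/

section RandomMaps

open ProbabilityTheory Filter Topology

/-! ### Head and tail of an i.i.d. sequence -/

/-- Prepending a coordinate to a sequence. -/
def seqCons {Ω : Type*} (p : Ω × (ℕ → Ω)) : ℕ → Ω
  | 0 => p.1
  | n + 1 => p.2 n

lemma measurable_seqCons {Ω : Type*} [MeasurableSpace Ω] :
    Measurable (seqCons : Ω × (ℕ → Ω) → ℕ → Ω) := by
  refine measurable_pi_iff.2 fun n => ?_
  cases n with
  | zero => exact measurable_fst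
  | succ n => exact (measurable_pi_apply n).comp measurable_snd

lemma map_seqCons_prod_infinitePi {Ω : Type*} [MeasurableSpace Ω] (P : Measure Ω)
    [IsProbabilityMeasure P] :
    (P.prod (Measure.infinitePi fun _ : ℕ => P)).map seqCons =
      Measure.infinitePi fun _ : ℕ => P := by
  classical
  refine Measure.eq_infinitePi _ fun s t ht => ?_
  obtain ⟨N, hN⟩ := s.exists_nat_subset_range
  -- Filling the unconstrained coordinates with `univ` turns the index set into an initial segment,
  -- whose product splits off coordinate 0.
  let t' : ℕ → Set Ω := fun i => if i ∈ s then t i else Set.univ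
  have ht' : ∀ i, MeasurableSet (t' i) := fun i => by
    by_cases h : i ∈ s <;> simp [t', h, ht]
  have hpre : seqCons ⁻¹' ((s : Set ℕ).pi t) =
      t' 0 ×ˢ ((Finset.range N : Finset ℕ) : Set ℕ).pi fun i => t' (i + 1) := by
    ext p
    simp only [Set.mem_preimage, Set.mem_pi, Set.mem_prod, Finset.mem_coe]
    constructor
    · intro h
      refine ⟨?_, fun i _ => ?_⟩
      · by_cases h0 : 0 ∈ s
        · simpa [t', h0, seqCons] using h 0 h0
        · simp [t', h0]
      · by_cases h0 : i + 1 ∈ s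
        · simpa [t', h0, seqCons] using h (i + 1) h0
        · simp [t', h0]
    · rintro ⟨h0, h1⟩ i hi
      cases i with
      | zero => simpa [t', hi, seqCons] using h0
      | succ i =>
        have hiN := hN hi
        have := h1 i (by simp at hiN ⊢; omega)
        simpa [t', hi, seqCons] using this
  rw [Measure.map_apply measurable_seqCons (.pi s.countable_toSet fun i _ => ht i), hpre,
    Measure.prod_prod, Measure.infinitePi_pi _ fun i _ => ht' (i + 1), mul_comm,
    ← Finset.prod_range_succ' (fun i => P (t' i)),
    ← Finset.prod_subset (hN.trans (Finset.range_mono N.le_succ))]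
  · exact Finset.prod_congr rfl fun i hi => by simp [t', hi]
  · intro i _ hi
    simp [t', hi]

lemma measurePreserving_head_tail_infinitePi {Ω : Type*} [MeasurableSpace Ω] (P : Measure Ω)
    [IsProbabilityMeasure P] :
    MeasurePreserving (fun ω : ℕ → Ω => (ω 0, fun n => ω (n + 1)))
      (Measure.infinitePi fun _ : ℕ => P) (P.prod (Measure.infinitePi fun _ : ℕ => P)) := by
  have hm : Measurable (fun ω : ℕ → Ω => (ω 0, fun n => ω (n + 1))) := by fun_prop
  refine ⟨hm, ?_⟩
  conv_lhs => rw [← map_seqCons_prod_infinitePi P]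
  rw [Measure.map_map hm measurable_seqCons]
  exact Measure.map_id

/-! ### Mean-square contractions: existence -/

variable {Ω Ω' E : Type*} [MeasurableSpace Ω] [MeasurableSpace Ω'] [NormedAddCommGroup E]
  [MeasurableSpace E] [BorelSpace E] [SecondCountableTopology E]
  {P : Measure Ω} [IsProbabilityMeasure P] {Q : Measure Ω'} [IsProbabilityMeasure Q]
  {Φ : Ω × E → E} {r : ℝ≥0}

lemma eLpNorm_two_sq {α F : Type*} [MeasurableSpace α] [NormedAddCommGroup F] (μ : Measure α)
    (g : α → F) : eLpNorm g 2 μ ^ 2 = ∫⁻ x, ‖g x‖ₑ ^ 2 ∂μ := by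
  simpa using eLpNorm_nnreal_pow_eq_lintegral (f := g) (μ := μ) (p := 2) two_ne_zero

/-- By Tonelli, `ξ` is integrated first with `ω` frozen, so `hr` applies at the points `X ω`, `Y ω`.
-/
lemma eLpNorm_prod_sub_le (hΦ : Measurable Φ)
    (hr : ∀ x y, eLpNorm (fun ξ => Φ (ξ, x) - Φ (ξ, y)) 2 P ≤ r * ‖x - y‖ₑ)
    {X Y : Ω' → E} (hX : AEMeasurable X Q) (hY : AEMeasurable Y Q) :
    eLpNorm (fun p : Ω × Ω' => Φ (p.1, X p.2) - Φ (p.1, Y p.2)) 2 (P.prod Q) ≤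
      r * eLpNorm (X - Y) 2 Q := by
  have hm : ∀ {Z : Ω' → E}, AEMeasurable Z Q →
      AEMeasurable (fun p : Ω × Ω' => Φ (p.1, Z p.2)) (P.prod Q) := fun hZ =>
    hΦ.comp_aemeasurable (measurable_fst.aemeasurable.prodMk hZ.comp_snd)
  refine (ENNReal.pow_le_pow_left_iff two_ne_zero).1 ?_
  rw [mul_pow, eLpNorm_two_sq, eLpNorm_two_sq,
    lintegral_prod_symm (fun p : Ω × Ω' => ‖Φ (p.1, X p.2) - Φ (p.1, Y p.2)‖ₑ ^ 2)
      (((hm hX).sub (hm hY)).enorm.pow_const 2),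
    ← lintegral_const_mul' _ _ (by finiteness)]
  refine lintegral_mono fun ω => ?_
  rw [← eLpNorm_two_sq P fun ξ => Φ (ξ, X ω) - Φ (ξ, Y ω), ← mul_pow]
  exact pow_le_pow_left' (hr _ _) 2

lemma memLp_prod_comp (hΦ : Measurable Φ)
    (hr : ∀ x y, eLpNorm (fun ξ => Φ (ξ, x) - Φ (ξ, y)) 2 P ≤ r * ‖x - y‖ₑ)
    (h0 : MemLp (fun ξ => Φ (ξ, 0)) 2 P) {X : Ω' → E} (hX : MemLp X 2 Q) :
    MemLp (fun p : Ω × Ω' => Φ (p.1, X p.2)) 2 (P.prod Q) := by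
  have hXm := hX.1.aemeasurable
  have hm : ∀ {Z : Ω' → E}, AEMeasurable Z Q →
      AEMeasurable (fun p : Ω × Ω' => Φ (p.1, Z p.2)) (P.prod Q) := fun hZ =>
    hΦ.comp_aemeasurable (measurable_fst.aemeasurable.prodMk hZ.comp_snd)
  have h1 : MemLp (fun p : Ω × Ω' => Φ (p.1, X p.2) - Φ (p.1, (0 : Ω' → E) p.2)) 2
      (P.prod Q) := by
    refine ⟨((hm hXm).sub (hm aemeasurable_const)).aestronglyMeasurable, ?_⟩
    refine (eLpNorm_prod_sub_le (Y := 0) hΦ hr hXm aemeasurable_const).trans_lt ?_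
    rw [sub_zero]
    exact ENNReal.mul_lt_top ENNReal.coe_lt_top hX.2
  have h2 : MemLp (fun p : Ω × Ω' => Φ (p.1, 0)) 2 (P.prod Q) :=
    h0.comp_measurePreserving measurePreserving_fst
  simpa [Pi.add_def] using h1.add h2

/-- A random map that contracts in mean square has a square-integrable stationary state. -/
theorem exists_stationary_of_contracting [CompleteSpace E] (hΦ : Measurable Φ) (hr1 : r < 1)
    (hr : ∀ x y, eLpNorm (fun ξ => Φ (ξ, x) - Φ (ξ, y)) 2 P ≤ r * ‖x - y‖ₑ)
    (h0 : MemLp (fun ξ => Φ (ξ, 0)) 2 P) :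
    ∃ μ : Measure E, IsProbabilityMeasure μ ∧ μ = (P.prod μ).map Φ := by
  let Q : Measure (ℕ → Ω) := Measure.infinitePi fun _ => P
  let θ : (ℕ → Ω) → Ω × (ℕ → Ω) := fun ω => (ω 0, fun n => ω (n + 1))
  have hθ : MeasurePreserving θ Q (P.prod Q) := measurePreserving_head_tail_infinitePi P
  have hmem : ∀ X : Lp E 2 Q,
      MemLp ((fun p : Ω × (ℕ → Ω) => Φ (p.1, X p.2)) ∘ θ) 2 Q := fun X =>
    (memLp_prod_comp hΦ hr h0 (Lp.memLp X)).comp_measurePreserving hθ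
  let T : Lp E 2 Q → Lp E 2 Q := fun X => (hmem X).toLp
  have hT : ContractingWith r T := by
    refine ⟨hr1, fun X Y => ?_⟩
    have hX := (Lp.memLp X).1.aemeasurable
    have hY := (Lp.memLp Y).1.aemeasurable
    have hsub := (memLp_prod_comp hΦ hr h0 (Lp.memLp X)).sub
      (memLp_prod_comp hΦ hr h0 (Lp.memLp Y))
    rw [Lp.edist_toLp_toLp, Lp.edist_def]
    exact (eLpNorm_comp_measurePreserving hsub.1 hθ).trans_le
      (eLpNorm_prod_sub_le hΦ hr hX hY)
  obtain ⟨X, hX, -⟩ := hT.exists_fixedPoint 0 (edist_ne_top _ _)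
  have hXm : AEMeasurable X Q := (Lp.memLp X).1.aemeasurable
  have hfix : X =ᵐ[Q] (fun p : Ω × (ℕ → Ω) => Φ (p.1, X p.2)) ∘ θ := by
    conv_lhs => rw [← hX.eq]
    exact (hmem X).coeFn_toLp
  have hpair : AEMeasurable (fun p : Ω × (ℕ → Ω) => (p.1, X p.2)) (P.prod Q) :=
    measurable_fst.aemeasurable.prodMk hXm.comp_snd
  refine ⟨Q.map X, Measure.isProbabilityMeasure_map hXm, ?_⟩
  have hprod : P.prod (Q.map X) = (P.prod Q).map fun p => (p.1, X p.2) := by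
    have := Measure.map_prod_map P Q measurable_id (Lp.stronglyMeasurable X).measurable
    rwa [Measure.map_id] at this
  -- Both sides become laws of functions on sequence space: `X` and its image under the fixed-point
  -- equation.
  rw [hprod, AEMeasurable.map_map_of_aemeasurable hΦ.aemeasurable hpair, ← hθ.map_eq,
    AEMeasurable.map_map_of_aemeasurable (hθ.map_eq.symm ▸ hΦ.comp_aemeasurable hpair)
      hθ.aemeasurable]
  exact Measure.map_congr hfix

/-! ### Mean-square contractions: uniqueness -/

/-- The witness is the one-step average of `h`. Its Lipschitz bound needs only first moments, which
`L²` norms dominate on a probability space. It does not depend on `μ`, so different stationary laws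
can be compared. -/
lemma exists_lipschitz_integral_eq (hΦ : Measurable Φ)
    (hr : ∀ x y, eLpNorm (fun ξ => Φ (ξ, x) - Φ (ξ, y)) 2 P ≤ r * ‖x - y‖ₑ)
    {K : ℝ≥0} {h : E → ℂ} (hK : LipschitzWith K h) (h1 : ∀ x, ‖h x‖ ≤ 1) :
    ∃ g : E → ℂ, LipschitzWith (K * r) g ∧ (∀ x, ‖g x‖ ≤ 1) ∧
      ∀ μ : Measure E, IsProbabilityMeasure μ → μ = (P.prod μ).map Φ →
        ∫ x, h x ∂μ = ∫ x, g x ∂μ := by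
  have hhΦ : Measurable fun p => h (Φ p) := hK.continuous.measurable.comp hΦ
  have hint : ∀ x, Integrable (fun ξ => h (Φ (ξ, x))) P := fun x =>
    Integrable.of_bound (hhΦ.comp measurable_prodMk_right).aestronglyMeasurable 1
      (.of_forall fun ξ => h1 _)
  refine ⟨fun x => ∫ ξ, h (Φ (ξ, x)) ∂P, fun x y => ?_, fun x => ?_, fun μ hμ hinv => ?_⟩
  · rw [edist_eq_enorm_sub, edist_eq_enorm_sub, ← integral_sub (hint x) (hint y)]
    calc ‖∫ ξ, h (Φ (ξ, x)) - h (Φ (ξ, y)) ∂P‖ₑ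
        ≤ ∫⁻ ξ, ‖h (Φ (ξ, x)) - h (Φ (ξ, y))‖ₑ ∂P := enorm_integral_le_lintegral_enorm _
      _ ≤ ∫⁻ ξ, K * ‖Φ (ξ, x) - Φ (ξ, y)‖ₑ ∂P := lintegral_mono fun ξ => by
          simpa only [edist_eq_enorm_sub] using hK (Φ (ξ, x)) (Φ (ξ, y))
      _ = K * eLpNorm (fun ξ => Φ (ξ, x) - Φ (ξ, y)) 1 P := by
          rw [lintegral_const_mul' _ _ ENNReal.coe_ne_top, eLpNorm_one_eq_lintegral_enorm]
      _ ≤ K * eLpNorm (fun ξ => Φ (ξ, x) - Φ (ξ, y)) 2 P := by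
          gcongr
          exact eLpNorm_le_eLpNorm_of_exponent_le one_le_two
            ((hΦ.comp measurable_prodMk_right).sub
              (hΦ.comp measurable_prodMk_right)).aestronglyMeasurable
      _ ≤ K * (r * ‖x - y‖ₑ) := by
          gcongr
          exact hr x y
      _ = _ := by rw [ENNReal.coe_mul, mul_assoc]
  · simpa using norm_integral_le_of_norm_le_const (μ := P) (C := 1)
      (.of_forall fun ξ => h1 (Φ (ξ, x)))
  · conv_lhs => rw [hinv]
    rw [integral_map hΦ.aemeasurable hK.continuous.measurable.aestronglyMeasurable,
      integral_prod_symm]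
    exact Integrable.of_bound hhΦ.aestronglyMeasurable 1 (.of_forall fun p => h1 _)

lemma exists_lipschitz_pow_integral_eq (hΦ : Measurable Φ)
    (hr : ∀ x y, eLpNorm (fun ξ => Φ (ξ, x) - Φ (ξ, y)) 2 P ≤ r * ‖x - y‖ₑ)
    {K : ℝ≥0} {h : E → ℂ} (hK : LipschitzWith K h) (h1 : ∀ x, ‖h x‖ ≤ 1) (n : ℕ) :
    ∃ g : E → ℂ, LipschitzWith (K * r ^ n) g ∧ (∀ x, ‖g x‖ ≤ 1) ∧
      ∀ μ : Measure E, IsProbabilityMeasure μ → μ = (P.prod μ).map Φ →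
        ∫ x, h x ∂μ = ∫ x, g x ∂μ := by
  induction n with
  | zero => exact ⟨h, by simpa using hK, h1, fun _ _ _ => rfl⟩
  | succ n ih =>
    obtain ⟨g, hg, hg1, hgi⟩ := ih
    obtain ⟨g', hg', hg1', hgi'⟩ := exists_lipschitz_integral_eq hΦ hr hg hg1
    exact ⟨g', by rwa [pow_succ, ← mul_assoc], hg1', fun μ hμ hinv =>
      (hgi μ hμ hinv).trans (hgi' μ hμ hinv)⟩

lemma integral_eq_of_stationary (hΦ : Measurable Φ) (hr1 : r < 1)
    (hr : ∀ x y, eLpNorm (fun ξ => Φ (ξ, x) - Φ (ξ, y)) 2 P ≤ r * ‖x - y‖ₑ)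
    {K : ℝ≥0} {h : E → ℂ} (hK : LipschitzWith K h) (h1 : ∀ x, ‖h x‖ ≤ 1)
    {μ ν : Measure E} [IsProbabilityMeasure μ] [IsProbabilityMeasure ν]
    (hμ : μ = (P.prod μ).map Φ) (hν : ν = (P.prod ν).map Φ) :
    ∫ x, h x ∂μ = ∫ x, h x ∂ν := by
  choose g hg hg1 hgi using exists_lipschitz_pow_integral_eq hΦ hr hK h1
  have hpow : Tendsto (fun n => (r : ℝ) ^ n) atTop (𝓝 0) :=
    tendsto_pow_atTop_nhds_zero_of_lt_one r.2 (by exact_mod_cast hr1)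
  -- The numbers `g n 0` serve every stationary law at once. Pointwise `g n x - g n 0` tends to 0,
  -- and the bound 2 allows dominated convergence.
  have key : ∀ μ : Measure E, IsProbabilityMeasure μ → μ = (P.prod μ).map Φ →
      Tendsto (fun n => ∫ x, h x ∂μ - g n 0) atTop (𝓝 0) := by
    intro μ hμ hinv
    have hlim : Tendsto (fun n => ∫ x, (g n x - g n 0) ∂μ) atTop (𝓝 (∫ _, (0 : ℂ) ∂μ)) := by
      refine tendsto_integral_of_dominated_convergence (fun _ => 2)
        (fun n => ((hg n).continuous.measurable.sub_const _).aestronglyMeasurable)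
        (integrable_const _) (fun n => .of_forall fun x => ?_) (.of_forall fun x => ?_)
      · exact (norm_sub_le _ _).trans (by linarith [hg1 n x, hg1 n 0])
      · refine squeeze_zero_norm (a := fun n => K * (r : ℝ) ^ n * ‖x‖) (fun n => ?_) ?_
        · simpa [dist_eq_norm] using (hg n).dist_le_mul x 0
        · simpa using (hpow.const_mul (K : ℝ)).mul_const ‖x‖
    rw [integral_zero] at hlim
    refine hlim.congr fun n => ?_
    rw [integral_sub _ (integrable_const _), ← hgi n μ hμ hinv]
    · simp
    · exact Integrable.of_bound (hg n).continuous.measurable.aestronglyMeasurable 1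
        (.of_forall (hg1 n))
  have := (key μ ‹_› hμ).sub (key ν ‹_› hν)
  simp only [sub_sub_sub_cancel_right, sub_zero] at this
  exact sub_eq_zero.1 (tendsto_nhds_unique tendsto_const_nhds this)

lemma lipschitzWith_exp_inner {E : Type*} [NormedAddCommGroup E] [InnerProductSpace ℝ E]
    (t : E) : LipschitzWith ‖t‖₊ fun x : E => Complex.exp (inner ℝ x t * Complex.I) := by
  refine LipschitzWith.of_dist_le_mul fun x y => ?_
  have hexp : Complex.exp (inner ℝ x t * Complex.I) - Complex.exp (inner ℝ y t * Complex.I) =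
      Complex.exp (inner ℝ y t * Complex.I) *
        (Complex.exp (Complex.I * (inner ℝ (x - y) t : ℝ)) - 1) := by
    rw [mul_sub, ← Complex.exp_add, mul_one, inner_sub_left]
    push_cast
    ring_nf
  rw [dist_eq_norm, dist_eq_norm, hexp, norm_mul, Complex.norm_exp_ofReal_mul_I, one_mul,
    coe_nnnorm, mul_comm ‖t‖]
  exact Real.norm_exp_I_mul_ofReal_sub_one_le.trans (norm_inner_le_norm (x - y) t)

/-- A random map that contracts in mean square has exactly one stationary distribution. -/
theorem existsUnique_stationary_of_contracting {E : Type*} [NormedAddCommGroup E]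
    [InnerProductSpace ℝ E] [CompleteSpace E] [MeasurableSpace E] [BorelSpace E]
    [SecondCountableTopology E] {Φ : Ω × E → E} (hΦ : Measurable Φ) (hr1 : r < 1)
    (hr : ∀ x y, eLpNorm (fun ξ => Φ (ξ, x) - Φ (ξ, y)) 2 P ≤ r * ‖x - y‖ₑ)
    (h0 : MemLp (fun ξ => Φ (ξ, 0)) 2 P) :
    ∃! μ : Measure E, IsProbabilityMeasure μ ∧ μ = (P.prod μ).map Φ := by
  obtain ⟨μ, hμ, hinv⟩ := exists_stationary_of_contracting hΦ hr1 hr h0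
  refine ⟨μ, ⟨hμ, hinv⟩, fun ν ⟨hν, hinv'⟩ => Measure.ext_of_charFun ?_⟩
  ext t
  rw [charFun_apply, charFun_apply]
  exact integral_eq_of_stationary hΦ hr1 hr (lipschitzWith_exp_inner t)
    (fun x => (Complex.norm_exp_ofReal_mul_I _).le) hinv' hinv

end RandomMaps

/-! ### Strong monotonicity of gradients -/

section Gradient

variable {E : Type*} [NormedAddCommGroup E] [InnerProductSpace ℝ E] [CompleteSpace E]

/-- The gradient of a strongly convex function is strongly monotone. -/
lemma StrongConvexOn.mul_norm_sq_le_inner_gradient_sub {g : E → ℝ} {m : ℝ}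
    (hg : StrongConvexOn Set.univ m g) (hd : Differentiable ℝ g) (x y : E) :
    m * ‖x - y‖ ^ 2 ≤ inner ℝ (gradient g x - gradient g y) (x - y) := by
  let l : ℝ → E := fun t => y + t • (x - y)
  have hl : ∀ t, HasDerivAt l (x - y) t := fun t => by
    have := ((hasDerivAt_id t).smul_const (x - y)).const_add y
    rwa [one_smul] at this
  -- Removing the quadratic leaves a convex function on the line through `y` and `x`; its
  -- derivatives at 0 and 1 are compared.
  let F : ℝ → ℝ := fun t => g (l t) - m / 2 * ‖l t‖ ^ 2
  have hF : ConvexOn ℝ Set.univ F := by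
    have h := (strongConvexOn_iff_convex.1 hg).comp_affineMap (AffineMap.lineMap y x)
    have hcomp : (fun z => g z - m / 2 * ‖z‖ ^ 2) ∘ AffineMap.lineMap y x = F := by
      funext t
      simp [F, l, AffineMap.lineMap_apply, add_comm]
    rwa [hcomp] at h
  have hF' : ∀ t, HasDerivAt F
      (inner ℝ (gradient g (l t)) (x - y) - m * inner ℝ (l t) (x - y)) t := by
    intro t
    have h1 : HasDerivAt (fun t => g (l t)) (inner ℝ (gradient g (l t)) (x - y)) t := by
      have h := (hd (l t)).hasGradientAt.hasFDerivAt.comp_hasDerivAt t (hl t)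
      rwa [InnerProductSpace.toDual_apply_apply] at h
    have h2 := ((hl t).norm_sq).const_mul (m / 2)
    exact (h1.sub h2).congr_deriv (by ring)
  have hmono := hF.monotoneOn_deriv (fun t _ => (hF' t).differentiableAt)
    (Set.mem_univ 0) (Set.mem_univ 1) zero_le_one
  rw [(hF' 0).deriv, (hF' 1).deriv] at hmono
  have l0 : l 0 = y := by simp [l]
  have l1 : l 1 = x := by simp [l]
  rw [l0, l1] at hmono
  have e : inner ℝ x (x - y) - inner ℝ y (x - y) = ‖x - y‖ ^ 2 := by
    rw [← inner_sub_left, real_inner_self_eq_norm_sq]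
  rw [inner_sub_left, ← e]
  linarith

end Gradient

/-! ### Stochastic gradient descent -/

section SGD

variable {Ω : Type*} {d : ℕ} {f : Ω → EuclideanSpace ℝ (Fin d) → ℝ} {α : ℝ}

lemma norm_sgdStep_sub_sq_le {ξ : Ω} {x y : EuclideanSpace ℝ (Fin d)} {K : ℝ≥0} {c : ℝ}
    (hα : 0 ≤ α) (hK : LipschitzWith K (gradient (f ξ)))
    (hc : c ≤ inner ℝ (gradient (f ξ) x - gradient (f ξ) y) (x - y)) :
    ‖sgdStep f α ξ x - sgdStep f α ξ y‖ ^ 2 ≤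
      (1 + α ^ 2 * K ^ 2) * ‖x - y‖ ^ 2 - 2 * α * c := by
  have e : sgdStep f α ξ x - sgdStep f α ξ y =
      (x - y) - α • (gradient (f ξ) x - gradient (f ξ) y) := by
    simp only [sgdStep, smul_sub]
    abel
  have hL : ‖gradient (f ξ) x - gradient (f ξ) y‖ ≤ K * ‖x - y‖ := by
    simpa [dist_eq_norm] using hK.dist_le_mul x y
  have hL2 := pow_le_pow_left₀ (norm_nonneg _) hL 2
  rw [e, norm_sub_sq_real, inner_smul_right, norm_smul, mul_pow, Real.norm_eq_abs, sq_abs,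
    real_inner_comm]
  nlinarith [mul_le_mul_of_nonneg_left hL2 (sq_nonneg α), mul_le_mul_of_nonneg_left hc hα]

variable [MeasurableSpace Ω] {P : Measure Ω}

lemma measurable_uncurry_sgdStep (hc : ∀ ξ, Continuous (gradient (f ξ)))
    (hgmeas : ∀ x, Measurable fun ξ => gradient (f ξ) x) :
    Measurable fun p : Ω × EuclideanSpace ℝ (Fin d) => sgdStep f α p.1 p.2 := by
  have h : Measurable (Function.uncurry fun x ξ => gradient (f ξ) x) :=
    measurable_uncurry_of_continuous_of_measurable hc hgmeas
  exact measurable_snd.sub ((h.comp measurable_swap).const_smul α)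

lemma isSGDInvariant_iff_eq_map [SFinite P]
    (hm : Measurable fun p : Ω × EuclideanSpace ℝ (Fin d) => sgdStep f α p.1 p.2)
    {μ : Measure (EuclideanSpace ℝ (Fin d))} [SFinite μ] :
    IsSGDInvariant P f α μ ↔ μ = (P.prod μ).map fun p => sgdStep f α p.1 p.2 := by
  have key : ∀ B, MeasurableSet B →
      ((P.prod μ).map fun p => sgdStep f α p.1 p.2) B = ∫⁻ x, sgdTransition P f α B x ∂μ :=
    fun B hB => by
      rw [Measure.map_apply hm hB, Measure.prod_apply_symm (hm hB)]
      rfl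
  constructor
  · intro h
    ext B hB
    rw [h B hB, key B hB]
  · intro h B hB
    rw [← key B hB, ← h]

/-- One step of SGD with a small step size contracts in mean square. -/
lemma eLpNorm_sgdStep_sub_le [IsProbabilityMeasure P] (hα : 0 ≤ α)
    (hconv : ∀ ξ, ConvexOn ℝ Set.univ (f ξ)) (hdiff : ∀ ξ, Differentiable ℝ (f ξ))
    (hgmeas : ∀ x, Measurable fun ξ => gradient (f ξ) x) {K : ℝ≥0}
    (hK : ∀ᵐ ξ ∂P, LipschitzWith K (gradient (f ξ))) {S : Set Ω} {δ : ℝ} (hδ : 0 ≤ δ)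
    (hS : ∀ ξ ∈ S, StrongConvexOn Set.univ δ (f ξ)) (x y : EuclideanSpace ℝ (Fin d)) :
    eLpNorm (fun ξ => sgdStep f α ξ x - sgdStep f α ξ y) 2 P ≤
      NNReal.sqrt (1 + α ^ 2 * K ^ 2 - 2 * α * δ * P.real S).toNNReal * ‖x - y‖ₑ := by
  -- `S` need not be measurable. For the fixed pair `x`, `y`, this measurable superset keeps the
  -- only consequence of strong convexity that is used; off it, plain convexity gives the bound 0.
  let T : Set Ω :=
    {ξ | δ * ‖x - y‖ ^ 2 ≤ inner ℝ (gradient (f ξ) x - gradient (f ξ) y) (x - y)}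
  have hT : MeasurableSet T := measurableSet_le measurable_const
    (((hgmeas x).sub (hgmeas y)).inner measurable_const)
  have hST : S ⊆ T := fun ξ hξ => (hS ξ hξ).mul_norm_sq_le_inner_gradient_sub (hdiff ξ) x y
  let H : Ω → ℝ := fun ξ =>
    (1 + α ^ 2 * K ^ 2) * ‖x - y‖ ^ 2 - 2 * α * T.indicator (fun _ => δ * ‖x - y‖ ^ 2) ξ
  have hle : ∀ᵐ ξ ∂P, ‖sgdStep f α ξ x - sgdStep f α ξ y‖ ^ 2 ≤ H ξ := by
    filter_upwards [hK] with ξ hξ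
    refine norm_sgdStep_sub_sq_le hα hξ ?_
    by_cases hξT : ξ ∈ T
    · rw [Set.indicator_of_mem hξT]
      exact hξT
    · simpa [hξT] using (strongConvexOn_zero.2 (hconv ξ)).mul_norm_sq_le_inner_gradient_sub
        (hdiff ξ) x y
  have hind : Integrable (T.indicator fun _ => δ * ‖x - y‖ ^ 2) P :=
    (integrable_const _).indicator hT
  have hHint : Integrable H P := (integrable_const _).sub (hind.const_mul _)
  have hHval : ∫ ξ, H ξ ∂P ≤ (1 + α ^ 2 * K ^ 2 - 2 * α * δ * P.real S) * ‖x - y‖ ^ 2 := by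
    have : P.real S ≤ P.real T := measureReal_mono hST
    rw [integral_sub (integrable_const _) (hind.const_mul _), integral_const_mul (2 * α),
      integral_indicator_const _ hT]
    simp only [integral_const, probReal_univ, smul_eq_mul]
    have : 0 ≤ 2 * α * δ * ‖x - y‖ ^ 2 * (P.real T - P.real S) := by
      have := sub_nonneg.2 this
      positivity
    linarith
  refine (ENNReal.pow_le_pow_left_iff two_ne_zero).1 ?_
  rw [eLpNorm_two_sq, mul_pow, ← ENNReal.coe_pow, NNReal.sq_sqrt]
  calc ∫⁻ ξ, ‖sgdStep f α ξ x - sgdStep f α ξ y‖ₑ ^ 2 ∂P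
      ≤ ∫⁻ ξ, ENNReal.ofReal (H ξ) ∂P := by
        refine lintegral_mono_ae ?_
        filter_upwards [hle] with ξ hξ
        rw [← ofReal_norm, ← ENNReal.ofReal_pow (norm_nonneg _)]
        exact ENNReal.ofReal_le_ofReal hξ
    _ = ENNReal.ofReal (∫ ξ, H ξ ∂P) :=
        (ofReal_integral_eq_lintegral_ofReal hHint
          (hle.mono fun ξ hξ => (sq_nonneg _).trans hξ)).symm
    _ ≤ ENNReal.ofReal ((1 + α ^ 2 * K ^ 2 - 2 * α * δ * P.real S) * ‖x - y‖ ^ 2) :=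
        ENNReal.ofReal_le_ofReal hHval
    _ = _ := by
        rw [ENNReal.ofReal_mul' (sq_nonneg _), ENNReal.ofReal_pow (norm_nonneg _), ofReal_norm]
        rfl

/-- Countable subadditivity over the levels `1 / (n + 1) ≤ m ξ`. It holds for outer measure, so `m`
need not be measurable. -/
lemma exists_uniform_strongConvexOn {S : Set Ω} (hPS : 0 < P S) {m : Ω → ℝ}
    (hm : ∀ ξ ∈ S, 0 < m ξ) (hstrong : ∀ ξ ∈ S, StrongConvexOn Set.univ (m ξ) (f ξ)) :
    ∃ δ > 0, ∃ S' : Set Ω, 0 < P S' ∧ ∀ ξ ∈ S', StrongConvexOn Set.univ δ (f ξ) := by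
  have hU : S ⊆ ⋃ n : ℕ, {ξ ∈ S | 1 / ((n : ℝ) + 1) ≤ m ξ} := fun ξ hξ => by
    obtain ⟨n, hn⟩ := exists_nat_one_div_lt (hm ξ hξ)
    exact Set.mem_iUnion.2 ⟨n, hξ, hn.le⟩
  obtain ⟨n, hn⟩ : ∃ n : ℕ, 0 < P {ξ ∈ S | 1 / ((n : ℝ) + 1) ≤ m ξ} := by
    by_contra! h
    exact hPS.ne' (measure_mono_null hU (measure_iUnion_null fun n => nonpos_iff_eq_zero.1 (h n)))
  exact ⟨_, Nat.one_div_pos_of_nat, _, hn, fun ξ hξ => (hstrong ξ hξ.1).mono hξ.2⟩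

lemma ae_lipschitzWith_gradient {L : Ω → ℝ≥0} (hsmooth : ∀ ξ, IsLSmooth (L ξ) (f ξ))
    (hLess : essSup (fun ξ => (L ξ : ℝ≥0∞)) P < ∞) :
    ∃ K : ℝ≥0, ∀ᵐ ξ ∂P, LipschitzWith K (gradient (f ξ)) := by
  refine ⟨(essSup (fun ξ => (L ξ : ℝ≥0∞)) P).toNNReal, ?_⟩
  filter_upwards [ENNReal.ae_le_essSup fun ξ => (L ξ : ℝ≥0∞)] with ξ hξ
  refine (hsmooth ξ).2.weaken ?_
  rwa [← ENNReal.coe_le_coe, ENNReal.coe_toNNReal hLess.ne]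

end SGD

theorem mainTheorem4 {Ω : Type*} [MeasurableSpace Ω] (P : Measure Ω) [IsProbabilityMeasure P]
    {d : ℕ} (f : Ω → EuclideanSpace ℝ (Fin d) → ℝ)
    (hconv : ∀ ξ, ConvexOn ℝ Set.univ (f ξ))
    (L : Ω → ℝ≥0) (hLmeas : Measurable L)
    (hsmooth : ∀ ξ, IsLSmooth (L ξ) (f ξ))
    (hLess : essSup (fun ξ => (L ξ : ℝ≥0∞)) P < ∞)
    (hfmeas : ∀ x, Measurable fun ξ => f ξ x)
    (hfsq : ∀ x, MemLp (fun ξ => f ξ x) 2 P)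
    (hgmeas : ∀ x, Measurable fun ξ => gradient (f ξ) x)
    (hgsq : ∀ x, MemLp (fun ξ => gradient (f ξ) x) 2 P)
    (S : Set Ω) (hS : MeasurableSet S) (hPS : 0 < P S)
    (m : Ω → ℝ) (hm : ∀ ξ ∈ S, 0 < m ξ)
    (hstrong : ∀ ξ ∈ S, StrongConvexOn Set.univ (m ξ) (f ξ)) :
    ∃ α₀ : ℝ, 0 < α₀ ∧ ∀ α : ℝ, 0 < α → α < α₀ →
      ∃! μ : Measure (EuclideanSpace ℝ (Fin d)),
        IsProbabilityMeasure μ ∧ IsSGDInvariant P f α μ := by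
  obtain ⟨K, hK⟩ := ae_lipschitzWith_gradient hsmooth hLess
  obtain ⟨δ, hδ, S', hPS', hS'⟩ := exists_uniform_strongConvexOn hPS hm hstrong
  have hp : 0 < P.real S' := ENNReal.toReal_pos hPS'.ne' (measure_ne_top _ _)
  -- Below this threshold `α ^ 2 * K ^ 2` is less than half of the gain `2 * α * δ * P.real S'`; the
  -- `+ 1` covers `K = 0`.
  refine ⟨δ * P.real S' / (K ^ 2 + 1), by positivity, fun α hα hα₀ => ?_⟩
  have hmeas := measurable_uncurry_sgdStep (α := α) (fun ξ => (hsmooth ξ).2.continuous) hgmeas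
  have hcontr : NNReal.sqrt (1 + α ^ 2 * K ^ 2 - 2 * α * δ * P.real S').toNNReal < 1 := by
    rw [← NNReal.sqrt_one, NNReal.sqrt_lt_sqrt, Real.toNNReal_lt_one]
    rw [lt_div_iff₀ (by positivity)] at hα₀
    nlinarith [mul_lt_mul_of_pos_left hα₀ hα, mul_pos hα (mul_pos hδ hp)]
  have h0 : MemLp (fun ξ => sgdStep f α ξ 0) 2 P :=
    (memLp_const 0).sub ((hgsq 0).const_smul α)
  obtain ⟨μ, ⟨hμ, hinv⟩, huniq⟩ := existsUnique_stationary_of_contracting hmeas hcontr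
    (eLpNorm_sgdStep_sub_le hα.le hconv (fun ξ => (hsmooth ξ).1) hgmeas hK hδ.le hS') h0
  exact ⟨μ, ⟨hμ, (isSGDInvariant_iff_eq_map hmeas).2 hinv⟩, fun ν ⟨hν, hinv'⟩ =>
    huniq ν ⟨hν, (isSGDInvariant_iff_eq_map hmeas).1 hinv'⟩⟩
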